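/- Let $(N,g)$ be a smooth finite-dimensional Riemannian manifold (without boundary), let $V\colon N\to\mathbb{R}$ be a smooth function, and let $\phi\colon\mathbb{R}^n\to N$ be a smooth harmonic map with potential $V$, that is, a smooth map satisfying $\tau(\phi)=-\nabla V(\phi)$, where $\tau(\phi)=\operatorname{tr}\nabla d\phi$ is the tension field of $\phi$ (with respect to the Euclidean metric on $\mathbb{R}^n$ and the metric $g$ on $N$) and $\nabla V$ is the gradient of $V$ on $(N,g)$. For $x\in\mathbb{R}^n$ and $r>0$ let $B_r(x)$ be the open Euclidean ball of radius $r$ around $x$, let $d\sigma$ be the surface measure on $\partial B_r(x)$, and let $\frac{\partial\phi}{\partial r}(y)=d\phi_y\big(\frac{y-x}{|y-x|}\big)$ be the radial derivative of $\phi$. Then, for every $x\in\mathbb{R}^n$ and every $r>0$, all the integrals below converge absolutely, the function $\rho\mapsto\rho^{2-n}\int_{B_\rho(x)}\big(\tfrac12|d\phi|^2-V(\phi)\big)\,dy$ is differentiable at $\rho=r$, and $$\frac{d}{dr}\left(r^{2-n}\int_{B_r(x)}\Big(\tfrac12|d\phi|^2-V(\phi)\Big)\,dy\right)=r^{2-n}\int_{\partial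 B_r(x)}\Big|\frac{\partial\phi}{\partial r}\Big|^2\,d\sigma-2r^{1-n}\int_{B_r(x)}V(\phi)\,dy .$$ -/

import Mathlib

open scoped Manifold ContDiff Bundle

noncomputable section

namespace HarmonicPotential

/-- The model space `ℝⁿ` with its Euclidean structure. -/
abbrev E (n : ℕ) : Type := EuclideanSpace ℝ (Fin n)

/-- The `i`-th standard basis vector of `ℝⁿ`. -/
def stdVec {n : ℕ} (i : Fin n) : E n := EuclideanSpace.single i (1 : ℝ)

section Target

variable {m : ℕ} {N : Type*} [TopologicalSpace N] [ChartedSpace (E m) N]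

/-- The coordinate vector field `∂/∂yᵃ` of the chart of `N` around `p`, at the point of `N` with
coordinates `y`. -/
def coordVec (p : N) (y : E m) (a : Fin m) :
    TangentSpace (𝓡 m) ((extChartAt (𝓡 m) p).symm y) :=
  mfderiv (𝓡 m) (𝓡 m) (extChartAt (𝓡 m) p).symm y (stdVec a)

variable [IsManifold (𝓡 m) ∞ N]
  [Bundle.RiemannianBundle (fun q : N ↦ TangentSpace (𝓡 m) q)]

/-- The matrix `g_{ab}(y) = ⟨∂/∂yᵃ, ∂/∂yᵇ⟩` of the Riemannian metric of `N` in the chart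
around `p`. -/
def metricMatrix (p : N) (y : E m) : Matrix (Fin m) (Fin m) ℝ :=
  Matrix.of fun a b ↦ inner ℝ (coordVec p y a) (coordVec p y b)

/-- The partial derivative `∂g_{ab}/∂yᶜ` at the point with coordinates `y`. -/
def dMetric (p : N) (y : E m) (c a b : Fin m) : ℝ :=
  fderiv ℝ (fun z : E m ↦ metricMatrix p z a b) y (stdVec c)

/-- The Christoffel symbols
`Γᶜ_{ab} = ½ ∑_d g^{cd} (∂_a g_{bd} + ∂_b g_{ad} - ∂_d g_{ab})`
of the Levi-Civita connection of `N` in the chart around `p`, at the point with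
coordinates `y`. -/
def christoffel (p : N) (y : E m) (c a b : Fin m) : ℝ :=
  (1 / 2 : ℝ) * ∑ d, (metricMatrix p y)⁻¹ c d *
    (dMetric p y a b d + dMetric p y b a d - dMetric p y d a b)

/-- The gradient `∇V` of a function `V` on `N`: the tangent vector at `p` that represents the
differential of `V` at `p` through the Riemannian metric. -/
def grad (V : N → ℝ) (p : N) : TangentSpace (𝓡 m) p :=
  haveI : FiniteDimensional ℝ (TangentSpace (𝓡 m) p) :=
    inferInstanceAs (FiniteDimensional ℝ (E m))
  haveI : CompleteSpace (TangentSpace (𝓡 m) p) := FiniteDimensional.complete ℝ _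
  (InnerProductSpace.toDual ℝ (TangentSpace (𝓡 m) p)).symm (mfderiv (𝓡 m) 𝓘(ℝ, ℝ) V p)

/-- The components
`τᶜ = Δ φᶜ + ∑_{i,a,b} Γᶜ_{ab}(φ) ∂_i φᵃ ∂_i φᵇ`
at `x` of the tension field of a map `φ : ℝⁿ → N`, in the chart of `N` around `φ x`. -/
def tensionCoord {n : ℕ} (φ : E n → N) (x : E n) (c : Fin m) : ℝ :=
  let ψ := extChartAt (𝓡 m) (φ x)
  let u : E n → E m := fun y ↦ ψ (φ y)
  (Laplacian.laplacian u x) c +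
    ∑ i, ∑ a, ∑ b, christoffel (m := m) (φ x) (ψ (φ x)) c a b *
      (fderiv ℝ u x (stdVec i)) a * (fderiv ℝ u x (stdVec i)) b

/-- The tension field `τ(φ) = tr ∇dφ` of a map `φ : ℝⁿ → N`, a vector field along `φ`: the
vector `∑_c τᶜ ∂/∂yᶜ`, where the coordinate vectors at `φ x` of the chart around `φ x` are the
images of the standard basis vectors under the inverse of the differential of the chart. -/
def tension {n : ℕ} (φ : E n → N) (x : E n) : TangentSpace (𝓡 m) (φ x) :=
  ∑ c, tensionCoord (m := m) φ x c •
    (mfderiv (𝓡 m) (𝓡 m) (extChartAt (𝓡 m) (φ x)) (φ x)).inverse (stdVec c)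

/-- `φ : ℝⁿ → N` is a smooth harmonic map with potential `V`: it is smooth and
`τ(φ) = -∇V(φ)`. -/
structure IsHarmonicMapWithPotential {n : ℕ} (V : N → ℝ) (φ : E n → N) : Prop where
  smooth : ContMDiff (𝓡 n) (𝓡 m) ∞ φ
  equation : ∀ x, tension (m := m) φ x = -grad V (φ x)

/-- `|dφ|²(x) = ∑_i |dφ(e_i)|²`. -/
def normSqDiff {n : ℕ} (φ : E n → N) (x : E n) : ℝ :=
  ∑ i, ‖mfderiv (𝓡 n) (𝓡 m) φ x (stdVec i)‖ ^ 2

/-- The energy density `½ |dφ|² - V(φ)`. -/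
def energyDensity {n : ℕ} (V : N → ℝ) (φ : E n → N) (x : E n) : ℝ :=
  (1 / 2 : ℝ) * normSqDiff (m := m) φ x - V (φ x)

/-- The radial derivative `∂φ/∂r` at `y`, for the polar coordinates centred at `x`: the image
under `dφ` of the unit vector `(y - x) / |y - x|`. -/
def radialDeriv {n : ℕ} (φ : E n → N) (x y : E n) : TangentSpace (𝓡 m) (φ y) :=
  let v : E n := ‖y - x‖⁻¹ • (y - x)
  mfderiv (𝓡 n) (𝓡 m) φ y v

end Target

/-- The surface measure `σ` of the sphere `∂B_r(x)` (`r > 0`), as a measure on `ℝⁿ`: the image of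
`rⁿ⁻¹` times the surface measure of the unit sphere under `s ↦ x + r s`. -/
def surfaceMeasure {n : ℕ} (x : E n) (r : ℝ) : MeasureTheory.Measure (E n) :=
  ENNReal.ofReal (r ^ (n - 1)) •
    ((MeasureTheory.volume : MeasureTheory.Measure (E n)).toSphere).map
      (fun s : Metric.sphere (0 : E n) 1 ↦ x + r • (s : E n))

end HarmonicPotential

end

/-! Let $e=\tfrac12|d\phi|^2-V(\phi)$ and $G_{ij}=\langle d\phi(e_i),d\phi(e_j)\rangle$. The
equation $\tau(\phi)=-\nabla V(\phi)$ makes the stress-energy tensor $e\,\delta_{ij}-G_{ij}$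
divergence free (`sum_fderiv_pullbackMetric`). Contracting it with $y-x$ gives a vector field whose
divergence is only the trace $ne-|d\phi|^2=(n-2)e-2V(\phi)$ (`sum_fderiv_stressField`).

On $\partial B_r(x)$ the product of this field with $y-x$ is $r^2e-r^2|\partial\phi/\partial r|^2$,
so the divergence theorem (`sphereIntegral_radial_eq_integral_divergence`) yields the identity
`sphereIntegral_radialDeriv`. Since $\frac{d}{dr}\int_{B_r}e=\int_{\partial B_r}e\,d\sigma$
(`hasDerivAt_integral_ball`), the product rule for $r^{2-n}\int_{B_r}e$ turns that identity,
multiplied by $r^{-n}$, into the theorem.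

The divergence theorem is obtained from integration by parts on all of $\mathbb{R}^n$ against a
radial cutoff. The conservation law is a computation in the chart around $\phi(x)$. -/

noncomputable section

namespace HarmonicPotential

open MeasureTheory Set Filter Topology

/-! ### Polar coordinates and the derivative of ball integrals. -/

section Analysis

variable {n : ℕ}

/-- The integral of `f` over the sphere of radius `s` around `x`, in polar coordinates. -/
def sphereIntegral (f : E n → ℝ) (x : E n) (s : ℝ) : ℝ :=
  s ^ (n - 1) * ∫ θ : Metric.sphere (0 : E n) 1, f (x + s • (θ : E n))
    ∂(volume : Measure (E n)).toSphere

theorem sphereIntegral_congr {f g : E n → ℝ} {x : E n} {s : ℝ} (hs : 0 ≤ s)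
    (h : ∀ y, ‖y - x‖ = s → f y = g y) : sphereIntegral f x s = sphereIntegral g x s := by
  unfold sphereIntegral
  congr 2
  ext θ
  apply h
  simp [norm_smul, abs_of_nonneg hs]

theorem sphereIntegral_const_mul (c : ℝ) (f : E n → ℝ) (x : E n) (s : ℝ) :
    sphereIntegral (fun y ↦ c * f y) x s = c * sphereIntegral f x s := by
  simp only [sphereIntegral, integral_const_mul]
  ring

theorem integrable_sphere {f : E n → ℝ} (hf : Continuous f) (x : E n) (s : ℝ) :
    Integrable (fun θ : Metric.sphere (0 : E n) 1 ↦ f (x + s • (θ : E n)))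
      (volume : Measure (E n)).toSphere := by
  have : Continuous fun θ : Metric.sphere (0 : E n) 1 ↦ f (x + s • (θ : E n)) := by fun_prop
  exact this.integrable_of_hasCompactSupport (HasCompactSupport.of_compactSpace _)

theorem sphereIntegral_sub {f g : E n → ℝ} (hf : Continuous f) (hg : Continuous g) (x : E n)
    (s : ℝ) : sphereIntegral (fun y ↦ f y - g y) x s =
      sphereIntegral f x s - sphereIntegral g x s := by
  simp only [sphereIntegral, integral_sub (integrable_sphere hf x s) (integrable_sphere hg x s)]
  ring

theorem continuous_sphereIntegral {f : E n → ℝ} (hf : Continuous f) (x : E n) :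
    Continuous (sphereIntegral f x) := by
  unfold sphereIntegral
  refine (continuous_pow _).mul ?_
  have : Continuous (Function.uncurry fun (s : ℝ) (θ : Metric.sphere (0 : E n) 1) ↦
      f (x + s • (θ : E n))) := by fun_prop
  simpa using continuous_parametric_integral_of_continuous
    (μ := (volume : Measure (E n)).toSphere) this (isCompact_univ)

/-- Integration in polar coordinates around `x`. -/
theorem integral_eq_integral_sphereIntegral (hn : n ≠ 0) {g : E n → ℝ} (hg : Integrable g)
    (x : E n) : ∫ y, g y = ∫ s in Ioi (0 : ℝ), sphereIntegral g x s := by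
  have : Nontrivial (E n) :=
    Module.nontrivial_of_finrank_pos (R := ℝ) (by simpa using Nat.pos_of_ne_zero hn)
  set μ : Measure (E n) := volume
  have hg' : Integrable (fun y ↦ g (x + y)) μ := hg.comp_add_left x
  have hmp := μ.measurePreserving_homeomorphUnitSphereProd
  have hemb := (Homeomorph.measurableEmbedding (homeomorphUnitSphereProd (E n)))
  let F : Metric.sphere (0 : E n) 1 × Ioi (0 : ℝ) → ℝ := fun p ↦ g (x + (p.2 : ℝ) • (p.1 : E n))
  have hF : ∀ y : ({0}ᶜ : Set (E n)), F (homeomorphUnitSphereProd (E n) y) = g (x + y) := by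
    intro y
    have hy : ‖(y : E n)‖ ≠ 0 := norm_ne_zero_iff.2 y.2
    simp [F, smul_smul, hy]
  have hint : Integrable F (μ.toSphere.prod (.volumeIoiPow (Module.finrank ℝ (E n) - 1))) := by
    rw [← hmp.integrable_comp_emb hemb]
    have h1 : IntegrableOn (fun y ↦ g (x + y)) ({0}ᶜ : Set (E n)) μ := hg'.integrableOn
    rw [integrableOn_iff_comap_subtypeVal (measurableSet_singleton _).compl] at h1
    exact h1.congr (Filter.Eventually.of_forall fun y ↦ (hF y).symm)
  calc ∫ y, g y = ∫ y, g (x + y) ∂μ := (integral_add_left_eq_self g x).symm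
    _ = ∫ y : ({(0)}ᶜ : Set (E n)), g (x + y) ∂(μ.comap (↑)) := by
      rw [integral_subtype_comap (measurableSet_singleton _).compl fun y ↦ g (x + y),
        restrict_compl_singleton]
    _ = ∫ p, F p ∂μ.toSphere.prod (.volumeIoiPow (Module.finrank ℝ (E n) - 1)) := by
      rw [← hmp.integral_comp hemb]
      exact integral_congr_ae (Filter.Eventually.of_forall fun y ↦ (hF y).symm)
    _ = ∫ s : Ioi (0 : ℝ), ∫ θ, g (x + (s : ℝ) • (θ : E n)) ∂μ.toSphere
          ∂.volumeIoiPow (Module.finrank ℝ (E n) - 1) := integral_prod_symm _ hint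
    _ = _ := by
      -- The radial measure has density $s^{n-1}$, which is the prefactor in `sphereIntegral`.
      simp only [Measure.volumeIoiPow, ENNReal.ofReal]
      rw [integral_withDensity_eq_integral_smul,
        integral_subtype_comap measurableSet_Ioi fun a ↦
          Real.toNNReal (a ^ (Module.finrank ℝ (E n) - 1)) •
            ∫ θ : Metric.sphere (0 : E n) 1, g (x + a • (θ : E n)) ∂μ.toSphere,
        setIntegral_congr_fun measurableSet_Ioi fun s hs ↦ ?_]
      · rw [NNReal.smul_def, Real.coe_toNNReal _ (pow_nonneg hs.out.le _)]
        simp [sphereIntegral, μ]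
      · exact (measurable_subtype_coe.pow_const _).real_toNNReal

theorem integrableOn_ball {f : E n → ℝ} (hf : Continuous f) (x : E n) (ρ : ℝ) :
    IntegrableOn f (Metric.ball x ρ) :=
  (hf.continuousOn.integrableOn_compact (isCompact_closedBall x ρ)).mono_set
    Metric.ball_subset_closedBall

/-- The indicator of the ball is constant on each sphere around $x$, so in polar coordinates it only
truncates the radial integral at $\rho$. -/
theorem integral_ball_eq (hn : n ≠ 0) {f : E n → ℝ} (hf : Continuous f) (x : E n) {ρ : ℝ}
    (hρ : 0 ≤ ρ) : ∫ y in Metric.ball x ρ, f y = ∫ s in (0)..ρ, sphereIntegral f x s := by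
  rw [← integral_indicator measurableSet_ball,
    integral_eq_integral_sphereIntegral hn
      ((integrable_indicator_iff measurableSet_ball).2 (integrableOn_ball hf x ρ)) x,
    intervalIntegral.integral_of_le hρ, integral_Ioc_eq_integral_Ioo,
    ← Ioi_inter_Iio, ← setIntegral_indicator measurableSet_Iio]
  refine setIntegral_congr_fun measurableSet_Ioi fun s hs ↦ ?_
  have hs : 0 < s := hs
  by_cases h : s < ρ
  · rw [indicator_of_mem (show s ∈ Iio ρ from h)]
    refine sphereIntegral_congr hs.le fun y hy ↦ ?_
    rw [indicator_of_mem]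
    simp [dist_eq_norm, hy, h]
  · rw [indicator_of_notMem (by simpa using h)]
    have : sphereIntegral ((Metric.ball x ρ).indicator fun y ↦ f y) x s =
        sphereIntegral (fun _ ↦ 0) x s := sphereIntegral_congr hs.le fun y hy ↦ by
      rw [indicator_of_notMem]
      simpa [dist_eq_norm, hy] using h
    rw [this]
    simp [sphereIntegral]

theorem hasDerivAt_integral_ball {f : E n → ℝ} (hf : Continuous f) (x : E n) {r : ℝ}
    (hr : 0 < r) :
    HasDerivAt (fun ρ ↦ ∫ y in Metric.ball x ρ, f y) (sphereIntegral f x r) r := by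
  rcases eq_or_ne n 0 with rfl | hn
  -- For $n=0$ every ball of positive radius is the whole one-point space and the sphere measure is
  -- zero, so both sides are derivatives of a constant.
  · have h0 : sphereIntegral f x r = 0 := by
      simp [sphereIntegral, (Measure.toSphere_eq_zero_iff_finrank (volume : Measure (E 0))).2]
    rw [h0]
    refine (hasDerivAt_const r (∫ y, f y)).congr_of_eventuallyEq ?_
    filter_upwards [lt_mem_nhds hr] with ρ hρ
    have : Metric.ball x ρ = univ := by
      ext y
      simp [Subsingleton.elim y x, hρ]
    rw [this, setIntegral_univ]
  · have hc := continuous_sphereIntegral hf x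
    refine (hc.integral_hasStrictDerivAt 0 r).hasDerivAt.congr_of_eventuallyEq ?_
    filter_upwards [lt_mem_nhds hr] with ρ hρ
    exact integral_ball_eq hn hf x hρ.le

end Analysis

/-! ### The divergence theorem on a ball. -/

section Analysis

variable {n : ℕ}

/-- Integration in polar coordinates against a radial cutoff. -/
theorem integral_radial_mul (hn : n ≠ 0) {p : ℝ → ℝ} (hp : Continuous p) {ρ : ℝ} (hρ : 0 < ρ)
    (hpρ : ∀ t, ρ ^ 2 ≤ t → p t = 0) {f : E n → ℝ} (hf : Continuous f) (x : E n) :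
    HasCompactSupport (fun y : E n ↦ p (‖y - x‖ ^ 2)) ∧
    ∫ y, p (‖y - x‖ ^ 2) * f y = ∫ s in (0)..ρ, p (s ^ 2) * sphereIntegral f x s := by
  have hcs : HasCompactSupport (fun y : E n ↦ p (‖y - x‖ ^ 2)) := by
    refine HasCompactSupport.intro (isCompact_closedBall x ρ) fun y hy ↦ hpρ _ ?_
    have : ρ < ‖y - x‖ := by simpa [dist_eq_norm] using hy
    gcongr
  refine ⟨hcs, ?_⟩
  have hint : Integrable (fun y ↦ p (‖y - x‖ ^ 2) * f y) :=
    Continuous.integrable_of_hasCompactSupport (by fun_prop) hcs.mul_right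
  rw [integral_eq_integral_sphereIntegral hn hint x, intervalIntegral.integral_of_le hρ.le]
  have key : ∀ s, 0 < s → sphereIntegral (fun y ↦ p (‖y - x‖ ^ 2) * f y) x s =
      p (s ^ 2) * sphereIntegral f x s := fun s hs ↦ by
    rw [← sphereIntegral_const_mul]
    exact sphereIntegral_congr hs.le fun y hy ↦ by rw [hy]
  rw [setIntegral_congr_fun measurableSet_Ioi fun s hs ↦ key s hs]
  refine (setIntegral_eq_of_subset_of_forall_sdiff_eq_zero measurableSet_Ioi
    (fun s hs ↦ hs.1) fun s hs ↦ ?_)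
  have h1 : 0 < s := hs.1
  have h2 : ρ < s := by
    by_contra! h
    exact hs.2 ⟨h1, h⟩
  rw [hpρ (s ^ 2) (by gcongr), zero_mul]

/-- Integration by parts in each coordinate, with $\nabla\big(h(|y-x|^2)\big)=-2k(|y-x|^2)(y-x)$.
Using the squared norm keeps the cutoff differentiable at the centre. -/
theorem integral_radial_mul_divergence (hn : n ≠ 0) {W : Fin n → E n → ℝ}
    (hW : ∀ j, ContDiff ℝ 1 (W j)) {h k : ℝ → ℝ} (hk : Continuous k)
    (hh : ∀ t, HasDerivAt h (-k t) t) {ρ : ℝ} (hρ : 0 < ρ) (hhρ : ∀ t, ρ ^ 2 ≤ t → h t = 0)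
    (hkρ : ∀ t, ρ ^ 2 ≤ t → k t = 0) (x : E n) :
    ∫ y, h (‖y - x‖ ^ 2) * ∑ j, fderiv ℝ (W j) y (stdVec j) =
      ∫ y, k (‖y - x‖ ^ 2) * (2 * ∑ j, (y - x) j * W j y) := by
  have hhc : Continuous h := continuous_iff_continuousAt.2 fun t ↦ (hh t).continuousAt
  have csh := (integral_radial_mul hn hhc hρ hhρ continuous_const (f := fun _ : E n ↦ 0) x).1
  have csk := (integral_radial_mul hn hk hρ hkρ continuous_const (f := fun _ : E n ↦ 0) x).1
  have hη : ∀ y : E n, HasFDerivAt (fun y ↦ h (‖y - x‖ ^ 2))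
      ((-k (‖y - x‖ ^ 2)) • (2 • innerSL ℝ (y - x))) y := fun y ↦ by
    have h1 : HasFDerivAt (fun y : E n ↦ ‖y - x‖ ^ 2) (2 • innerSL ℝ (y - x)) y := by
      have := ((hasFDerivAt_id y).sub_const x).norm_sq
      simpa using this
    exact (hh _).comp_hasFDerivAt y h1
  have hηj : ∀ (y : E n) (j : Fin n), fderiv ℝ (fun y ↦ h (‖y - x‖ ^ 2)) y (stdVec j) =
      -(k (‖y - x‖ ^ 2) * (2 * (y - x) j)) := fun y j ↦ by
    rw [(hη y).fderiv]
    simp [stdVec, EuclideanSpace.inner_single_right]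
  have hd : ∀ j, Continuous fun y ↦ fderiv ℝ (W j) y (stdVec j) := fun j ↦
    ((hW j).continuous_fderiv one_ne_zero).clm_apply continuous_const
  have hWc : ∀ j, Continuous (W j) := fun j ↦ (hW j).continuous
  have i1 : ∀ j, Integrable fun y ↦ h (‖y - x‖ ^ 2) * fderiv ℝ (W j) y (stdVec j) := fun j ↦ by
    have := hd j
    exact Continuous.integrable_of_hasCompactSupport (by fun_prop) csh.mul_right
  have i2 : ∀ j, Integrable fun y ↦ k (‖y - x‖ ^ 2) * (2 * ((y - x) j * W j y)) := fun j ↦ by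
    have := hWc j
    exact Continuous.integrable_of_hasCompactSupport (by fun_prop) csk.mul_right
  have i3 : ∀ j, Integrable fun y ↦ h (‖y - x‖ ^ 2) * W j y := fun j ↦ by
    have := hWc j
    exact Continuous.integrable_of_hasCompactSupport (by fun_prop) csh.mul_right
  simp only [Finset.mul_sum]
  rw [integral_finsetSum _ fun j _ ↦ i1 j, integral_finsetSum _ fun j _ ↦ i2 j]
  refine Finset.sum_congr rfl fun j _ ↦ ?_
  rw [integral_mul_fderiv_eq_neg_fderiv_mul_of_integrable, ← integral_neg]
  · refine integral_congr_ae (Filter.Eventually.of_forall fun y ↦ ?_)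
    simp only [hηj]
    ring
  · refine (i2 j).neg.congr (Filter.Eventually.of_forall fun y ↦ ?_)
    simp only [hηj, Pi.neg_apply]
    ring
  · exact i1 j
  · exact i3 j
  · exact fun y _ ↦ (hη y).differentiableAt
  · exact fun y _ ↦ (hW j).differentiable one_ne_zero y

/-- The divergence theorem on a ball. -/
theorem sphereIntegral_radial_eq_integral_divergence {W : Fin n → E n → ℝ}
    (hW : ∀ j, ContDiff ℝ 1 (W j)) (x : E n) {r : ℝ} (hr : 0 < r) :
    sphereIntegral (fun y ↦ ∑ j, (y - x) j * W j y) x r =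
      r * ∫ y in Metric.ball x r, ∑ j, fderiv ℝ (W j) y (stdVec j) := by
  rcases eq_or_ne n 0 with rfl | hn
  · simp [sphereIntegral]
  have hd : Continuous fun y ↦ ∑ j, fderiv ℝ (W j) y (stdVec j) :=
    continuous_finsetSum _ fun j _ ↦
      ((hW j).continuous_fderiv one_ne_zero).clm_apply continuous_const
  have hWc : ∀ j, Continuous (W j) := fun j ↦ (hW j).continuous
  have hb : Continuous fun y : E n ↦ ∑ j, (y - x) j * W j y := by fun_prop
  set D := sphereIntegral (fun y ↦ ∑ j, fderiv ℝ (W j) y (stdVec j)) x with hD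
  set B := sphereIntegral (fun y ↦ ∑ j, (y - x) j * W j y) x with hB
  have hDc : Continuous D := continuous_sphereIntegral hd x
  have hBc : Continuous B := continuous_sphereIntegral hb x
  set I : ℝ → ℝ := fun s ↦ ∫ t in (0)..s, D t with hI
  have hI' : ∀ s, HasDerivAt I (D s) s := fun s ↦
    (hDc.integral_hasStrictDerivAt 0 s).hasDerivAt
  have hIc : Continuous I := continuous_iff_continuousAt.2 fun t ↦ (hI' t).continuousAt
  -- The defect of the claimed identity at radius $s$, since $I(s)$ is the integral of the
  -- divergence over $B_s(x)$.
  set q : ℝ → ℝ := fun s ↦ B s - s * I s with hq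
  have hqc : Continuous q := by fun_prop
  rw [integral_ball_eq hn hd x hr.le]
  change B r = r * I r
  by_contra hne
  have hqr : q r ≠ 0 := sub_ne_zero.2 hne
  set ρ : ℝ := r + 1
  have hρ : 0 < ρ := by positivity
  -- The test function contains the defect itself, so the tested identity becomes the vanishing of
  -- $\int_0^\rho 2(\rho^2-s^2)_+\,q(s)^2\,ds$. Any $\rho>r$ would give positive weight at $s=r$.
  set k : ℝ → ℝ := fun t ↦ max 0 (ρ ^ 2 - t) * q (√t) with hk
  have hkc : Continuous k := by fun_prop
  have hkρ : ∀ t, ρ ^ 2 ≤ t → k t = 0 := fun t ht ↦ by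
    simp [hk, max_eq_left (sub_nonpos.2 ht)]
  set h : ℝ → ℝ := fun t ↦ -∫ u in (ρ ^ 2)..t, k u with hhdef
  have hh : ∀ t, HasDerivAt h (-k t) t := fun t ↦
    ((hkc.integral_hasStrictDerivAt (ρ ^ 2) t).hasDerivAt).neg
  have hhρ : ∀ t, ρ ^ 2 ≤ t → h t = 0 := fun t ht ↦ by
    have : ∫ u in (ρ ^ 2)..t, k u = ∫ u in (ρ ^ 2)..t, (0 : ℝ) := by
      refine intervalIntegral.integral_congr fun u hu ↦ hkρ u ?_
      rw [uIcc_of_le ht] at hu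
      exact hu.1
    simp [hhdef, this]
  have hhc : Continuous h := continuous_iff_continuousAt.2 fun t ↦ (hh t).continuousAt
  have e1 := integral_radial_mul_divergence hn hW hkc hh hρ hhρ hkρ x
  rw [(integral_radial_mul hn hhc hρ hhρ hd x).2,
    (integral_radial_mul hn hkc hρ hkρ (f := fun y ↦ 2 * ∑ j, (y - x) j * W j y)
      (by fun_prop) x).2] at e1
  simp only [sphereIntegral_const_mul, ← hB, ← hD] at e1
  -- The integrand is the derivative of $h(s^2)I(s)$, which vanishes at both ends because $I(0)=0$
  -- and $h(\rho^2)=0$. This replaces $\int hD$ in `e1` by $\int 2ks\,I$.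
  have e2 : ∫ s in (0)..ρ, (h (s ^ 2) * D s + (-k (s ^ 2) * (2 * s)) * I s) = 0 := by
    have hder : ∀ s ∈ uIcc 0 ρ, HasDerivAt (fun s ↦ h (s ^ 2) * I s)
        (h (s ^ 2) * D s + (-k (s ^ 2) * (2 * s)) * I s) s := fun s _ ↦ by
      have h1 : HasDerivAt (fun s : ℝ ↦ h (s ^ 2)) (-k (s ^ 2) * (2 * s)) s := by
        have h2 : HasDerivAt (fun s : ℝ ↦ s ^ 2) (2 * s) s := by
          simpa using hasDerivAt_pow 2 s
        exact HasDerivAt.comp (h₂ := h) s (hh (s ^ 2)) h2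
      exact (h1.mul (hI' s)).congr_deriv (add_comm _ _)
    rw [intervalIntegral.integral_eq_sub_of_hasDerivAt hder
      (Continuous.intervalIntegrable (by fun_prop) _ _), hhρ _ le_rfl]
    simp [hI]
  have ii : ∀ {g : ℝ → ℝ}, Continuous g → IntervalIntegrable g volume 0 ρ :=
    fun hg ↦ hg.intervalIntegrable _ _
  rw [intervalIntegral.integral_add (ii (by fun_prop)) (ii (by fun_prop)), e1,
    ← intervalIntegral.integral_add (ii (by fun_prop)) (ii (by fun_prop))] at e2
  have hpos : 0 < ∫ s in (0)..ρ, (k (s ^ 2) * (2 * B s) + (-k (s ^ 2) * (2 * s)) * I s) := by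
    have hval : ∀ s, 0 ≤ s → k (s ^ 2) * (2 * B s) + (-k (s ^ 2) * (2 * s)) * I s =
        2 * (max 0 (ρ ^ 2 - s ^ 2) * q s ^ 2) := fun s hs ↦ by
      simp only [hk, Real.sqrt_sq hs, hq]
      ring
    refine intervalIntegral.integral_pos hρ (Continuous.continuousOn (by fun_prop)) ?_
      ⟨r, ⟨hr.le, by simp [ρ]⟩, ?_⟩
    · intro s hs
      rw [hval s hs.1.le]
      positivity
    · rw [hval r hr.le]
      have : 0 < ρ ^ 2 - r ^ 2 := by
        simp only [ρ]
        nlinarith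
      have := lt_max_of_lt_right (b := (0 : ℝ)) this
      positivity
  exact hpos.ne' e2

end Analysis

/-! ### The pulled-back metric and its expression in charts. -/

section Geometry

variable {n m : ℕ} {N : Type*} [TopologicalSpace N] [ChartedSpace (E m) N]

/-- This is the tangent map of `f` composed with the constant section $y\mapsto(y,v)$. The form as a
section along `f` is what `inner_bundle` needs for smoothness of inner products. -/
theorem contMDiffOn_mfderiv_apply [IsManifold (𝓡 m) ∞ N] {f : E n → N} {s : Set (E n)}
    (hs : IsOpen s) (hf : ContMDiffOn (𝓡 n) (𝓡 m) ∞ f s) (v : E n) :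
    ContMDiffOn (𝓡 n) (𝓡 m).tangent ∞
      (fun y ↦ (⟨f y, mfderiv (𝓡 n) (𝓡 m) f y v⟩ : TangentBundle (𝓡 m) N)) s := by
  have h1 := hf.contMDiffOn_tangentMapWithin (m := ∞) (by simp) hs.uniqueMDiffOn
  have h2 : ContMDiff (𝓡 n) (𝓡 n).tangent ∞
      (fun y : E n ↦ (⟨y, v⟩ : TangentBundle (𝓡 n) (E n))) :=
    contMDiff_vectorSpace_iff_contDiff.2 contDiff_const
  refine (h1.comp h2.contMDiffOn fun y hy ↦ hy).congr fun y hy ↦ ?_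
  simp only [Function.comp_apply, tangentMapWithin, mfderivWithin_of_isOpen hs hy]

/-- The tangent space at `p` is identified with the model space through the preferred chart at `p`,
so that chart has identity differential at its own centre. -/
theorem mfderiv_extChartAt_symm_self [IsManifold (𝓡 m) ∞ N] (p : N) :
    (mfderiv (𝓡 m) (𝓡 m) (extChartAt (𝓡 m) p).symm (extChartAt (𝓡 m) p p) : E m →L[ℝ] E m) =
      ContinuousLinearMap.id ℝ (E m) := by
  have : IsManifold (𝓡 m) 1 N := IsManifold.of_le (n := ∞) (by simp)
  have h := mfderivWithin_range_extChartAt_symm (I := 𝓡 m) (x := p)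
  have hr : range (𝓡 m) = univ := ModelWithCorners.Boundaryless.range_eq_univ
  rw [hr, mfderivWithin_univ] at h
  exact h

theorem coordVec_self [IsManifold (𝓡 m) ∞ N] (p : N) (a : Fin m) :
    (coordVec p (extChartAt (𝓡 m) p p) a : E m) = stdVec a := by
  have := congrArg (fun L : E m →L[ℝ] E m ↦ L (stdVec a)) (mfderiv_extChartAt_symm_self p)
  exact this

variable [Bundle.RiemannianBundle (fun q : N ↦ TangentSpace (𝓡 m) q)]

/-- The inner product of two vectors of the model space, seen as tangent vectors at `q`. -/
def innerAt (q : N) (v w : E m) : ℝ :=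
  inner ℝ (show TangentSpace (𝓡 m) q from v) (show TangentSpace (𝓡 m) q from w)

theorem innerAt_comm (q : N) (v w : E m) : innerAt q v w = innerAt q w v :=
  real_inner_comm (F := TangentSpace (𝓡 m) q) _ _

theorem innerAt_add_left (q : N) (v v' w : E m) :
    innerAt q (v + v') w = innerAt q v w + innerAt q v' w :=
  inner_add_left (E := TangentSpace (𝓡 m) q) _ _ _

theorem innerAt_smul_left (q : N) (c : ℝ) (v w : E m) :
    innerAt q (c • v) w = c * innerAt q v w :=
  real_inner_smul_left (F := TangentSpace (𝓡 m) q) _ _ _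

theorem innerAt_self_pos (q : N) {v : E m} (hv : v ≠ 0) : 0 < innerAt q v v :=
  real_inner_self_pos (F := TangentSpace (𝓡 m) q) |>.2 hv

/-- `innerAt q` as a bilinear map. -/
def innerAtₗ (q : N) : E m →ₗ[ℝ] E m →ₗ[ℝ] ℝ :=
  LinearMap.mk₂ ℝ (innerAt q) (innerAt_add_left q) (innerAt_smul_left q)
    (fun v w w' ↦ by simp only [innerAt_comm q v, innerAt_add_left])
    (fun c v w ↦ by simp only [innerAt_comm q v, innerAt_smul_left, smul_eq_mul])

theorem innerAt_sum_sum (q : N) {ι κ : Type*} [Fintype ι] [Fintype κ] (c : ι → ℝ) (d : κ → ℝ)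
    (v : ι → E m) (w : κ → E m) :
    innerAt q (∑ a, c a • v a) (∑ b, d b • w b) =
      ∑ a, ∑ b, innerAt q (v a) (w b) * c a * d b := by
  change innerAtₗ q _ _ = ∑ a, ∑ b, innerAtₗ q (v a) (w b) * c a * d b
  simp only [map_sum, map_smul, LinearMap.sum_apply, LinearMap.smul_apply, smul_eq_mul,
    Finset.mul_sum]
  rw [Finset.sum_comm]
  refine Finset.sum_congr rfl fun a _ ↦ Finset.sum_congr rfl fun b _ ↦ ?_
  ring

theorem sum_coord_smul_stdVec (v : E m) : ∑ a, v a • stdVec a = v := by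
  simpa [stdVec] using (EuclideanSpace.basisFun (Fin m) ℝ).sum_repr v

/-- The components `⟨dφ(e_i), dφ(e_j)⟩` of the pulled back metric. -/
def pullbackMetric (φ : E n → N) (i j : Fin n) (y : E n) : ℝ :=
  innerAt (m := m) (φ y) (mfderiv (𝓡 n) (𝓡 m) φ y (stdVec i))
    (mfderiv (𝓡 n) (𝓡 m) φ y (stdVec j))

theorem pullbackMetric_comm (φ : E n → N) (i j : Fin n) (y : E n) :
    pullbackMetric (m := m) φ i j y = pullbackMetric (m := m) φ j i y :=
  innerAt_comm _ _ _

theorem normSqDiff_eq (φ : E n → N) (y : E n) :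
    normSqDiff (m := m) φ y = ∑ i, pullbackMetric (m := m) φ i i y := by
  unfold normSqDiff
  refine Finset.sum_congr rfl fun i _ ↦ ?_
  exact (real_inner_self_eq_norm_sq (F := TangentSpace (𝓡 m) (φ y)) _).symm

theorem norm_mfderiv_sq_eq (φ : E n → N) (y v : E n) :
    ‖mfderiv (𝓡 n) (𝓡 m) φ y v‖ ^ 2 =
      ∑ i, ∑ j, pullbackMetric (m := m) φ i j y * v i * v j := by
  have h1 : ‖mfderiv (𝓡 n) (𝓡 m) φ y v‖ ^ 2 = innerAt (m := m) (φ y)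
      (mfderiv (𝓡 n) (𝓡 m) φ y v) (mfderiv (𝓡 n) (𝓡 m) φ y v) :=
    (real_inner_self_eq_norm_sq (F := TangentSpace (𝓡 m) (φ y)) _).symm
  have h2 : (mfderiv (𝓡 n) (𝓡 m) φ y v : E m) =
      ∑ i, v i • (mfderiv (𝓡 n) (𝓡 m) φ y (stdVec i) : E m) := by
    conv_lhs => rw [← sum_coord_smul_stdVec v]
    exact (map_sum (mfderiv (𝓡 n) (𝓡 m) φ y) _ _).trans
      (Finset.sum_congr rfl fun i _ ↦ map_smul (mfderiv (𝓡 n) (𝓡 m) φ y) _ _)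
  rw [h1]
  exact (congrArg₂ (innerAt (φ y)) h2 h2).trans (innerAt_sum_sum (φ y) v v
    (fun i ↦ (mfderiv (𝓡 n) (𝓡 m) φ y (stdVec i) : E m))
    (fun i ↦ (mfderiv (𝓡 n) (𝓡 m) φ y (stdVec i) : E m)))

theorem metricMatrix_apply (p : N) (y : E m) (a b : Fin m) :
    metricMatrix p y a b = innerAt ((extChartAt (𝓡 m) p).symm y)
      (coordVec p y a) (coordVec p y b) := rfl

theorem metricMatrix_comm (p : N) (y : E m) (a b : Fin m) :
    metricMatrix p y a b = metricMatrix p y b a := innerAt_comm _ _ _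

variable [IsManifold (𝓡 m) ∞ N]

section Smooth

variable [IsContMDiffRiemannianBundle (𝓡 m) ∞ (E m) (fun q : N ↦ TangentSpace (𝓡 m) q)]

theorem contDiff_pullbackMetric {φ : E n → N} (hφ : ContMDiff (𝓡 n) (𝓡 m) ∞ φ) (i j : Fin n) :
    ContDiff ℝ ∞ (pullbackMetric (m := m) φ i j) := by
  have h := fun v ↦ contMDiffOn_univ.1
    (contMDiffOn_mfderiv_apply isOpen_univ hφ.contMDiffOn v)
  exact contMDiff_iff_contDiff.1 ((h (stdVec i)).inner_bundle (h (stdVec j)))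

theorem contDiffOn_metricMatrix (p : N) (a b : Fin m) :
    ContDiffOn ℝ ∞ (fun y ↦ metricMatrix p y a b) (extChartAt (𝓡 m) p).target := by
  have h := fun v ↦ contMDiffOn_mfderiv_apply (isOpen_extChartAt_target p)
    (contMDiffOn_extChartAt_symm (I := 𝓡 m) (n := ∞) p) v
  exact contMDiffOn_iff_contDiffOn.1 ((h (stdVec a)).inner_bundle (h (stdVec b)))

end Smooth

theorem metricMatrix_self (p : N) (a b : Fin m) :
    metricMatrix p (extChartAt (𝓡 m) p p) a b = innerAt p (stdVec a) (stdVec b) := by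
  rw [metricMatrix_apply]
  erw [coordVec_self, coordVec_self]
  rw [extChartAt_to_inv]

/-- A nonzero kernel vector $v$ of the Gram matrix would satisfy $g(v,v)=0$, against positive
definiteness. -/
theorem isUnit_det_metricMatrix_self (p : N) :
    IsUnit (metricMatrix p (extChartAt (𝓡 m) p p)).det := by
  rw [isUnit_iff_ne_zero]
  intro h
  obtain ⟨v, hv, hv0⟩ := Matrix.exists_mulVec_eq_zero_iff.2 h
  have hne : (WithLp.toLp 2 v : E m) ≠ 0 := fun h ↦ hv (by simpa using h)
  refine (innerAt_self_pos p hne).ne' ?_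
  rw [← sum_coord_smul_stdVec (WithLp.toLp 2 v : E m), innerAt_sum_sum]
  refine Finset.sum_eq_zero fun a _ ↦ ?_
  have := congrFun hv0 a
  simp only [Matrix.mulVec, dotProduct, metricMatrix_self, Pi.zero_apply] at this
  calc _ = v a * ∑ b, innerAt p (stdVec a) (stdVec b) * v b := by
        rw [Finset.mul_sum]
        exact Finset.sum_congr rfl fun b _ ↦ by ring
    _ = 0 := by rw [this, mul_zero]

/-- The pulled back metric in a chart. -/
theorem pullbackMetric_eventuallyEq {φ : E n → N} (hφ : ContMDiff (𝓡 n) (𝓡 m) ∞ φ) (x : E n)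
    (i j : Fin n) :
    let u : E n → E m := fun y ↦ extChartAt (𝓡 m) (φ x) (φ y)
    pullbackMetric (m := m) φ i j =ᶠ[𝓝 x] fun y ↦ ∑ a, ∑ b, metricMatrix (φ x) (u y) a b *
      (fderiv ℝ u y (stdVec i)) a * (fderiv ℝ u y (stdVec j)) b := by
  intro u
  set ψ := extChartAt (𝓡 m) (φ x)
  have hsrc : ∀ᶠ y in 𝓝 x, φ y ∈ ψ.source :=
    hφ.continuous.continuousAt.preimage_mem_nhds (extChartAt_source_mem_nhds (φ x))
  -- The factorisation $\phi=\psi^{-1}\circ u$ must hold near each such $y$, not only at $y$, to be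
  -- differentiated there.
  filter_upwards [hsrc.eventually_nhds] with y hy
  have hys : φ y ∈ ψ.source := hy.self_of_nhds
  have heq : φ =ᶠ[𝓝 y] ψ.symm ∘ u := hy.mono fun z hz ↦ (ψ.left_inv hz).symm
  have hu : MDifferentiableAt (𝓡 n) (𝓡 m) u y :=
    ((contMDiffAt_extChartAt' (n := ∞) (by simpa [ψ] using hys)).comp y
      hφ.contMDiffAt).mdifferentiableAt (by simp)
  have hψ : MDifferentiableAt (𝓡 m) (𝓡 m) ψ.symm (u y) :=
    ((contMDiffOn_extChartAt_symm (I := 𝓡 m) (n := ∞) (φ x)).contMDiffAt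
      ((isOpen_extChartAt_target (φ x)).mem_nhds (ψ.map_source hys))).mdifferentiableAt (by simp)
  have hd : ∀ v : E n, (mfderiv (𝓡 n) (𝓡 m) φ y v : E m) =
      ∑ a, (fderiv ℝ u y v) a • (coordVec (φ x) (u y) a : E m) := fun v ↦ by
    have h1 : (mfderiv (𝓡 n) (𝓡 m) φ y v : E m) =
        mfderiv (𝓡 m) (𝓡 m) ψ.symm (u y) (fderiv ℝ u y v) := by
      have h2 : (mfderiv (𝓡 n) (𝓡 m) φ y : E n →L[ℝ] E m) =
        mfderiv (𝓡 n) (𝓡 m) (ψ.symm ∘ u) y := heq.mfderiv_eq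
      have h3 := mfderiv_comp y hψ hu
      rw [mfderiv_eq_fderiv] at h3
      exact congrArg (fun L : E n →L[ℝ] E m ↦ L v) (h2.trans h3)
    rw [h1]
    conv_lhs => rw [← sum_coord_smul_stdVec (fderiv ℝ u y v)]
    exact (map_sum (mfderiv (𝓡 m) (𝓡 m) ψ.symm (u y)) _ _).trans
      (Finset.sum_congr rfl fun a _ ↦ map_smul (mfderiv (𝓡 m) (𝓡 m) ψ.symm (u y)) _ _)
  have hpt : φ y = ψ.symm (u y) := heq.self_of_nhds
  refine (congrArg₂ (innerAt (φ y)) (hd (stdVec i)) (hd (stdVec j))).trans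
    ((innerAt_sum_sum (φ y) _ _ (fun a ↦ (coordVec (φ x) (u y) a : E m))
      (fun a ↦ (coordVec (φ x) (u y) a : E m))).trans ?_)
  rw [hpt]
  rfl

end Geometry

/-! ### The conservation law of the stress-energy tensor. -/

section StressEnergy

variable {n m : ℕ}

/-- To be read with $M_{cab}=\partial_c g_{ab}$, $P=\partial_i u$, $Q=\partial_j u$,
$H=\partial_i\partial_i u$, $K=\partial_i\partial_j u$. The terms in $K$ cancel by symmetry of $g$;
those in $M$, symmetrised in the two factors $P$, assemble into the lowered Christoffel symbol. -/
theorem stress_divergence_algebra {g : Fin m → Fin m → ℝ} (hg : ∀ a b, g a b = g b a)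
    {M Γ : Fin m → Fin m → Fin m → ℝ}
    (hΓ : ∀ b a a', ∑ c, g c b * Γ c a a' = (1 / 2 : ℝ) * (M a a' b + M a' a b - M b a a'))
    (P Q H K : Fin m → ℝ) :
    (∑ a, ∑ b, ((∑ c, M c a b * P c) * P a * Q b + g a b * H a * Q b + g a b * P a * K b)) -
      (1 / 2 : ℝ) * ∑ a, ∑ b,
        ((∑ c, M c a b * Q c) * P a * P b + g a b * K a * P b + g a b * P a * K b) =
    ∑ c, ∑ b, g c b * (H c + ∑ a, ∑ a', Γ c a a' * P a * P a') * Q b := by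
  have h1 : ∑ c, ∑ b, g c b * (∑ a, ∑ a', Γ c a a' * P a * P a') * Q b =
      ∑ b, ∑ a, ∑ a', (1 / 2 : ℝ) * (M a a' b + M a' a b - M b a a') * P a * P a' * Q b := by
    rw [Finset.sum_comm]
    refine Finset.sum_congr rfl fun b _ ↦ ?_
    simp only [← hΓ, Finset.mul_sum, Finset.sum_mul]
    rw [Finset.sum_comm]
    refine Finset.sum_congr rfl fun a _ ↦ ?_
    rw [Finset.sum_comm]
    refine Finset.sum_congr rfl fun a' _ ↦ Finset.sum_congr rfl fun c _ ↦ ?_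
    ring
  have h2 : ∑ a, ∑ b, (∑ c, M c a b * P c) * P a * Q b =
      ∑ b, ∑ a, ∑ a', M a' a b * P a * P a' * Q b := by
    rw [Finset.sum_comm]
    refine Finset.sum_congr rfl fun b _ ↦ Finset.sum_congr rfl fun a _ ↦ ?_
    simp only [Finset.sum_mul]
    refine Finset.sum_congr rfl fun c _ ↦ ?_
    ring
  have h2' : ∑ b, ∑ a, ∑ a', M a' a b * P a * P a' * Q b =
      ∑ b, ∑ a, ∑ a', M a a' b * P a * P a' * Q b := by
    refine Finset.sum_congr rfl fun b _ ↦ ?_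
    rw [Finset.sum_comm]
    refine Finset.sum_congr rfl fun a _ ↦ Finset.sum_congr rfl fun a' _ ↦ ?_
    ring
  have h3 : ∑ a, ∑ b, (∑ c, M c a b * Q c) * P a * P b =
      ∑ b, ∑ a, ∑ a', M b a a' * P a * P a' * Q b := by
    symm
    rw [Finset.sum_comm]
    refine Finset.sum_congr rfl fun a _ ↦ ?_
    rw [Finset.sum_comm]
    refine Finset.sum_congr rfl fun a' _ ↦ ?_
    simp only [Finset.sum_mul]
    refine Finset.sum_congr rfl fun c _ ↦ ?_
    ring
  have h4 : ∑ a, ∑ b, g a b * K a * P b = ∑ a, ∑ b, g a b * P a * K b := by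
    rw [Finset.sum_comm]
    refine Finset.sum_congr rfl fun a _ ↦ Finset.sum_congr rfl fun b _ ↦ ?_
    rw [hg]
    ring
  have h5 : ∑ b, ∑ a, ∑ a', (1 / 2 : ℝ) * (M a a' b + M a' a b - M b a a') * P a * P a' * Q b =
      (1 / 2 : ℝ) * (∑ b, ∑ a, ∑ a', M a a' b * P a * P a' * Q b +
        ∑ b, ∑ a, ∑ a', M a' a b * P a * P a' * Q b -
        ∑ b, ∑ a, ∑ a', M b a a' * P a * P a' * Q b) := by
    simp only [← Finset.sum_add_distrib, ← Finset.sum_sub_distrib, Finset.mul_sum]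
    refine Finset.sum_congr rfl fun b _ ↦ Finset.sum_congr rfl fun a _ ↦
      Finset.sum_congr rfl fun a' _ ↦ ?_
    ring
  have h6 : ∑ c, ∑ b, g c b * (H c + ∑ a, ∑ a', Γ c a a' * P a * P a') * Q b =
      ∑ c, ∑ b, g c b * H c * Q b +
        ∑ c, ∑ b, g c b * (∑ a, ∑ a', Γ c a a' * P a * P a') * Q b := by
    simp only [← Finset.sum_add_distrib]
    refine Finset.sum_congr rfl fun c _ ↦ Finset.sum_congr rfl fun b _ ↦ ?_
    ring
  rw [h6, h1, h5]
  simp only [Finset.sum_add_distrib]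
  rw [h2, h2', h3, h4]
  ring

theorem laplacian_apply {u : E n → E m} (x : E n) :
    Laplacian.laplacian u x =
      ∑ i, fderiv ℝ (fderiv ℝ u) x (stdVec i) (stdVec i) := by
  rw [InnerProductSpace.laplacian_eq_iteratedFDeriv_orthonormalBasis u
    (EuclideanSpace.basisFun (Fin n) ℝ)]
  simp [iteratedFDeriv_two_apply, stdVec]

variable {N : Type*} [TopologicalSpace N] [ChartedSpace (E m) N]

theorem contDiffAt_chart {φ : E n → N} (hφ : ContMDiff (𝓡 n) (𝓡 m) ∞ φ) (x : E n) :
    ContDiffAt ℝ ∞ (fun y ↦ extChartAt (𝓡 m) (φ x) (φ y)) x :=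
  contMDiffAt_iff_contDiffAt.1 ((contMDiffAt_extChartAt (n := ∞)).comp x hφ.contMDiffAt)

theorem fderiv_metricMatrix_apply
    [Bundle.RiemannianBundle (fun q : N ↦ TangentSpace (𝓡 m) q)] (p : N) (y : E m) (a b : Fin m) (v : E m) :
    fderiv ℝ (fun z ↦ metricMatrix p z a b) y v = ∑ c, dMetric p y c a b * v c := by
  conv_lhs => rw [← sum_coord_smul_stdVec v]
  simp only [map_sum, map_smul, smul_eq_mul, dMetric]
  exact Finset.sum_congr rfl fun c _ ↦ mul_comm _ _

variable [IsManifold (𝓡 m) ∞ N]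

theorem mfderiv_eq_fderiv_chart {φ : E n → N} (hφ : ContMDiff (𝓡 n) (𝓡 m) ∞ φ) (x : E n) :
    (mfderiv (𝓡 n) (𝓡 m) φ x : E n →L[ℝ] E m) =
      fderiv ℝ (fun y ↦ extChartAt (𝓡 m) (φ x) (φ y)) x := by
  have : IsManifold (𝓡 m) 1 N := IsManifold.of_le (n := ∞) (by simp)
  have h := mfderiv_comp x
    (mdifferentiableAt_extChartAt (I := 𝓡 m) (x := φ x) (y := φ x) (mem_chart_source _ _))
    (hφ.mdifferentiableAt (x := x) (by simp))
  rw [mfderiv_extChartAt_self, mfderiv_eq_fderiv] at h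
  exact h.symm

variable [Bundle.RiemannianBundle (fun q : N ↦ TangentSpace (𝓡 m) q)]

/-- Lowering the upper index cancels the inverse metric in the definition of `christoffel`. -/
theorem sum_metricMatrix_mul_christoffel (p : N) (b a a' : Fin m) :
    ∑ c, metricMatrix p (extChartAt (𝓡 m) p p) c b *
        christoffel p (extChartAt (𝓡 m) p p) c a a' =
      (1 / 2 : ℝ) * (dMetric p (extChartAt (𝓡 m) p p) a a' b +
        dMetric p (extChartAt (𝓡 m) p p) a' a b - dMetric p (extChartAt (𝓡 m) p p) b a a') := by
  set y := extChartAt (𝓡 m) p p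
  have h := Matrix.mul_nonsing_inv _ (isUnit_det_metricMatrix_self (m := m) p)
  have h' : ∀ d, ∑ c, metricMatrix p y c b * (metricMatrix p y)⁻¹ c d = if b = d then 1 else 0 :=
    fun d ↦ by
      have := congrFun (congrFun h b) d
      simp only [Matrix.mul_apply, Matrix.one_apply] at this
      rw [← this]
      exact Finset.sum_congr rfl fun c _ ↦ by rw [metricMatrix_comm p y c b]
  calc _ = (1 / 2 : ℝ) * ∑ d, (∑ c, metricMatrix p y c b * (metricMatrix p y)⁻¹ c d) *
        (dMetric p y a a' d + dMetric p y a' a d - dMetric p y d a a') := by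
        simp only [christoffel, Finset.mul_sum, Finset.sum_mul]
        rw [Finset.sum_comm]
        refine Finset.sum_congr rfl fun d _ ↦ Finset.sum_congr rfl fun c _ ↦ ?_
        ring
    _ = _ := by simp [h']

theorem tension_eq (φ : E n → N) (x : E n) :
    (tension (m := m) φ x : E m) = ∑ c, tensionCoord (m := m) φ x c • (stdVec c : E m) := by
  have : IsManifold (𝓡 m) 1 N := IsManifold.of_le (n := ∞) (by simp)
  unfold tension
  rw [mfderiv_extChartAt_self]
  refine Finset.sum_congr rfl fun c _ ↦ ?_
  have h : (ContinuousLinearMap.id ℝ (E m)).inverse (stdVec c) = stdVec c := by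
    rw [ContinuousLinearMap.inverse_id, ContinuousLinearMap.id_apply]
  exact congrArg _ h

/-- By the chain rule and the harmonic map equation, $d(V\circ\phi)(v)=\langle\nabla
V,d\phi(v)\rangle=-\langle\tau(\phi),d\phi(v)\rangle$, written in the chart centred at $\phi(x)$. -/
theorem fderiv_potential_comp {V : N → ℝ} (hV : ContMDiff (𝓡 m) 𝓘(ℝ, ℝ) ∞ V) {φ : E n → N}
    (hφ : IsHarmonicMapWithPotential (m := m) V φ) (x v : E n) :
    let u : E n → E m := fun y ↦ extChartAt (𝓡 m) (φ x) (φ y)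
    fderiv ℝ (fun y ↦ V (φ y)) x v = - ∑ c, ∑ b,
      metricMatrix (φ x) (u x) c b * tensionCoord (m := m) φ x c * (fderiv ℝ u x v) b := by
  intro u
  have h1 : fderiv ℝ (fun y ↦ V (φ y)) x v =
      mfderiv (𝓡 m) 𝓘(ℝ, ℝ) V (φ x) (mfderiv (𝓡 n) (𝓡 m) φ x v) := by
    have := mfderiv_comp x (hV.mdifferentiableAt (x := φ x) (by simp))
      (hφ.smooth.mdifferentiableAt (x := x) (by simp))
    rw [mfderiv_eq_fderiv] at this
    exact congrArg (fun L : E n →L[ℝ] ℝ ↦ L v) this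
  have h2 : mfderiv (𝓡 m) 𝓘(ℝ, ℝ) V (φ x) (mfderiv (𝓡 n) (𝓡 m) φ x v) =
      inner ℝ (grad V (φ x)) (mfderiv (𝓡 n) (𝓡 m) φ x v) := by
    have : FiniteDimensional ℝ (TangentSpace (𝓡 m) (φ x)) :=
      inferInstanceAs (FiniteDimensional ℝ (E m))
    have : CompleteSpace (TangentSpace (𝓡 m) (φ x)) := FiniteDimensional.complete ℝ _
    exact (InnerProductSpace.toDual_symm_apply (𝕜 := ℝ) (E := TangentSpace (𝓡 m) (φ x))).symm
  have h3 : grad V (φ x) = -tension (m := m) φ x := by rw [hφ.equation x, neg_neg]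
  have h4 : inner ℝ (tension (m := m) φ x) (mfderiv (𝓡 n) (𝓡 m) φ x v) =
      innerAt (φ x) (∑ c, tensionCoord (m := m) φ x c • (stdVec c : E m))
        (∑ b, (fderiv ℝ u x v) b • stdVec b) := by
    rw [sum_coord_smul_stdVec]
    exact congrArg₂ (innerAt (φ x)) (tension_eq φ x)
      (congrArg (fun L : E n →L[ℝ] E m ↦ L v) (mfderiv_eq_fderiv_chart hφ.smooth x))
  rw [h1, h2, h3, inner_neg_left, h4, innerAt_sum_sum]
  simp only [u, metricMatrix_self]

variable [IsContMDiffRiemannianBundle (𝓡 m) ∞ (E m) (fun q : N ↦ TangentSpace (𝓡 m) q)]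

theorem fderiv_pullbackMetric {φ : E n → N} (hφ : ContMDiff (𝓡 n) (𝓡 m) ∞ φ) (x : E n)
    (i j k : Fin n) :
    let u : E n → E m := fun y ↦ extChartAt (𝓡 m) (φ x) (φ y)
    fderiv ℝ (pullbackMetric (m := m) φ i j) x (stdVec k) = ∑ a, ∑ b,
      ((∑ c, dMetric (φ x) (u x) c a b * (fderiv ℝ u x (stdVec k)) c) *
          (fderiv ℝ u x (stdVec i)) a * (fderiv ℝ u x (stdVec j)) b +
        metricMatrix (φ x) (u x) a b * (fderiv ℝ (fderiv ℝ u) x (stdVec k) (stdVec i)) a *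
          (fderiv ℝ u x (stdVec j)) b +
        metricMatrix (φ x) (u x) a b * (fderiv ℝ u x (stdVec i)) a *
          (fderiv ℝ (fderiv ℝ u) x (stdVec k) (stdVec j)) b) := by
  intro u
  have hu : ContDiffAt ℝ ∞ u x := contDiffAt_chart hφ x
  have hu1 : HasFDerivAt u (fderiv ℝ u x) x := (hu.differentiableAt (by simp)).hasFDerivAt
  have hu2 : HasFDerivAt (fderiv ℝ u) (fderiv ℝ (fderiv ℝ u) x) x :=
    ((hu.fderiv_right (m := 1) (WithTop.coe_le_coe.2 (le_top : (2 : ℕ∞) ≤ ⊤))).differentiableAt (by simp)).hasFDerivAt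
  have hA : ∀ a b, HasFDerivAt (fun y ↦ metricMatrix (φ x) (u y) a b)
      ((fderiv ℝ (fun z ↦ metricMatrix (φ x) z a b) (u x)).comp (fderiv ℝ u x)) x := fun a b ↦ by
    have : DifferentiableAt ℝ (fun z ↦ metricMatrix (φ x) z a b) (u x) :=
      ((contDiffOn_metricMatrix (φ x) a b).contDiffAt
        ((isOpen_extChartAt_target (φ x)).mem_nhds
          (mem_extChartAt_target (φ x)))).differentiableAt (by simp)
    exact HasFDerivAt.comp (g := fun z ↦ metricMatrix (φ x) z a b) x this.hasFDerivAt hu1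
  have hB : ∀ (l : Fin n) (a : Fin m), HasFDerivAt (fun y ↦ (fderiv ℝ u y (stdVec l)) a)
      ((EuclideanSpace.proj (𝕜 := ℝ) a).comp
        ((ContinuousLinearMap.apply ℝ (E m) (stdVec l)).comp (fderiv ℝ (fderiv ℝ u) x))) x :=
    fun l a ↦ (EuclideanSpace.proj (𝕜 := ℝ) a).hasFDerivAt.comp x
      ((ContinuousLinearMap.apply ℝ (E m) (stdVec l)).hasFDerivAt.comp x hu2)
  have hG := HasFDerivAt.fun_sum (u := Finset.univ) fun (a : Fin m) _ ↦
    HasFDerivAt.fun_sum (u := Finset.univ) fun (b : Fin m) _ ↦ ((hA a b).mul (hB i a)).mul (hB j b)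
  have hG' := hG.congr_of_eventuallyEq (pullbackMetric_eventuallyEq hφ x i j)
  rw [hG'.fderiv]
  simp only [sum_apply]
  refine Finset.sum_congr rfl fun a _ ↦ Finset.sum_congr rfl fun b _ ↦ ?_
  simp [fderiv_metricMatrix_apply]
  ring

/-- The conservation law of the stress-energy tensor of a harmonic map with potential. -/
theorem sum_fderiv_pullbackMetric {V : N → ℝ} (hV : ContMDiff (𝓡 m) 𝓘(ℝ, ℝ) ∞ V) {φ : E n → N}
    (hφ : IsHarmonicMapWithPotential (m := m) V φ) (x : E n) (j : Fin n) :
    ∑ i, fderiv ℝ (pullbackMetric (m := m) φ i j) x (stdVec i) =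
      (1 / 2 : ℝ) * ∑ i, fderiv ℝ (pullbackMetric (m := m) φ i i) x (stdVec j) -
        fderiv ℝ (fun y ↦ V (φ y)) x (stdVec j) := by
  set u : E n → E m := fun y ↦ extChartAt (𝓡 m) (φ x) (φ y) with hu
  have hsymm : ∀ v w, fderiv ℝ (fderiv ℝ u) x v w = fderiv ℝ (fderiv ℝ u) x w v :=
    (contDiffAt_chart hφ.smooth x).isSymmSndFDerivAt 
      (by simpa using WithTop.coe_le_coe.2 (le_top : (2 : ℕ∞) ≤ ⊤))
  have h1 : ∀ i, fderiv ℝ (pullbackMetric (m := m) φ i j) x (stdVec i) -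
      (1 / 2 : ℝ) * fderiv ℝ (pullbackMetric (m := m) φ i i) x (stdVec j) =
      ∑ c, ∑ b, metricMatrix (φ x) (u x) c b *
        ((fderiv ℝ (fderiv ℝ u) x (stdVec i) (stdVec i)) c +
          ∑ a, ∑ a', christoffel (φ x) (u x) c a a' * (fderiv ℝ u x (stdVec i)) a *
            (fderiv ℝ u x (stdVec i)) a') * (fderiv ℝ u x (stdVec j)) b := fun i ↦ by
    rw [fderiv_pullbackMetric hφ.smooth, fderiv_pullbackMetric hφ.smooth]
    simp only [← hu, hsymm (stdVec j) (stdVec i)]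
    exact stress_divergence_algebra (metricMatrix_comm (φ x) (u x))
      (sum_metricMatrix_mul_christoffel (φ x)) _ (fun a ↦ (fderiv ℝ u x (stdVec j)) a)
      (fun a ↦ (fderiv ℝ (fderiv ℝ u) x (stdVec i) (stdVec i)) a)
      (fun a ↦ (fderiv ℝ (fderiv ℝ u) x (stdVec i) (stdVec j)) a)
  have h2 : fderiv ℝ (fun y ↦ V (φ y)) x (stdVec j) = - ∑ c, ∑ b,
      metricMatrix (φ x) (u x) c b * tensionCoord (m := m) φ x c *
        (fderiv ℝ u x (stdVec j)) b := fderiv_potential_comp hV hφ x _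
  rw [h2, sub_neg_eq_add, ← sub_eq_iff_eq_add', Finset.mul_sum,
    ← Finset.sum_sub_distrib, Finset.sum_congr rfl fun i _ ↦ h1 i, Finset.sum_comm]
  refine Finset.sum_congr rfl fun c _ ↦ ?_
  rw [Finset.sum_comm]
  refine Finset.sum_congr rfl fun b _ ↦ ?_
  rw [← Finset.sum_mul, ← Finset.mul_sum, Finset.sum_add_distrib]
  -- Summed over $i$, the second derivatives form the Laplacian, and with the Christoffel terms they
  -- give the component $\tau^c$.
  have h3 : tensionCoord (m := m) φ x c = (Laplacian.laplacian u x) c +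
      ∑ i, ∑ a, ∑ a', christoffel (φ x) (u x) c a a' * (fderiv ℝ u x (stdVec i)) a *
        (fderiv ℝ u x (stdVec i)) a' := rfl
  rw [h3, laplacian_apply]
  simp

end StressEnergy

/-! ### Flux of the stress-energy tensor and the radial derivative. -/

section Monotonicity

variable {n m : ℕ} {N : Type*} [TopologicalSpace N] [ChartedSpace (E m) N]

theorem integral_surfaceMeasure {f : E n → ℝ} (hf : Measurable f) (x : E n) {r : ℝ}
    (hr : 0 ≤ r) : ∫ y, f y ∂(surfaceMeasure x r) = sphereIntegral f x r := by
  have hm : Measurable fun s : Metric.sphere (0 : E n) 1 ↦ x + r • (s : E n) := by fun_prop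
  rw [surfaceMeasure, integral_smul_measure, integral_map hm.aemeasurable
    hf.aestronglyMeasurable, ENNReal.toReal_ofReal (pow_nonneg hr _)]
  rfl

/-- The comparison function `g` serves the radial derivative, whose formula is singular at the
centre but agrees on the sphere with a continuous function. -/
theorem integrable_surfaceMeasure {f g : E n → ℝ} (hf : Measurable f) (hg : Continuous g)
    (x : E n) {r : ℝ} (hr : 0 ≤ r) (hfg : ∀ y, ‖y - x‖ = r → f y = g y) :
    Integrable f (surfaceMeasure x r) := by
  have hm : Measurable fun s : Metric.sphere (0 : E n) 1 ↦ x + r • (s : E n) := by fun_prop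
  refine Integrable.smul_measure ?_ ENNReal.ofReal_ne_top
  rw [integrable_map_measure hf.aestronglyMeasurable hm.aemeasurable]
  refine (integrable_sphere hg x r).congr (Eventually.of_forall fun s ↦ (hfg _ ?_).symm)
  simp [norm_smul, abs_of_nonneg hr]

theorem contDiff_potential_comp {V : N → ℝ} (hV : ContMDiff (𝓡 m) 𝓘(ℝ, ℝ) ∞ V) {φ : E n → N}
    (hφ : ContMDiff (𝓡 n) (𝓡 m) ∞ φ) : ContDiff ℝ ∞ fun y ↦ V (φ y) :=
  contMDiff_iff_contDiff.1 (hV.comp hφ)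

variable [Bundle.RiemannianBundle (fun q : N ↦ TangentSpace (𝓡 m) q)]

theorem norm_radialDeriv_sq (φ : E n → N) (x y : E n) :
    ‖radialDeriv (m := m) φ x y‖ ^ 2 = (‖y - x‖ ^ 2)⁻¹ *
      ∑ i, ∑ j, pullbackMetric (m := m) φ i j y * (y - x) i * (y - x) j := by
  refine (norm_mfderiv_sq_eq φ y (‖y - x‖⁻¹ • (y - x))).trans ?_
  simp only [Finset.mul_sum, PiLp.smul_apply, smul_eq_mul]
  refine Finset.sum_congr rfl fun i _ ↦ Finset.sum_congr rfl fun j _ ↦ ?_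
  ring

theorem energyDensity_eq (V : N → ℝ) (φ : E n → N) :
    energyDensity (m := m) V φ =
      fun y ↦ (1 / 2 : ℝ) * ∑ i, pullbackMetric (m := m) φ i i y - V (φ y) := by
  ext y
  rw [energyDensity, normSqDiff_eq]

variable [IsManifold (𝓡 m) ∞ N]
  [IsContMDiffRiemannianBundle (𝓡 m) ∞ (E m) (fun q : N ↦ TangentSpace (𝓡 m) q)]

theorem contDiff_energyDensity {V : N → ℝ} (hV : ContMDiff (𝓡 m) 𝓘(ℝ, ℝ) ∞ V) {φ : E n → N}
    (hφ : ContMDiff (𝓡 n) (𝓡 m) ∞ φ) : ContDiff ℝ ∞ (energyDensity (m := m) V φ) := by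
  rw [energyDensity_eq]
  exact (contDiff_const.mul (ContDiff.sum fun i _ ↦ contDiff_pullbackMetric hφ i i)).sub
    (contDiff_potential_comp hV hφ)

/-- The contraction of the stress-energy tensor with the radial vector field. -/
def stressField (V : N → ℝ) (φ : E n → N) (x : E n) (j : Fin n) (y : E n) : ℝ :=
  energyDensity (m := m) V φ y * (y - x) j -
    ∑ i, pullbackMetric (m := m) φ i j y * (y - x) i

theorem contDiff_stressField {V : N → ℝ} (hV : ContMDiff (𝓡 m) 𝓘(ℝ, ℝ) ∞ V) {φ : E n → N}
    (hφ : ContMDiff (𝓡 n) (𝓡 m) ∞ φ) (x : E n) (j : Fin n) :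
    ContDiff ℝ ∞ (stressField (m := m) V φ x j) := by
  have h1 := fun i j ↦ contDiff_pullbackMetric hφ i j
  have h2 := contDiff_energyDensity hV hφ
  have h3 : ∀ j, ContDiff ℝ ∞ fun y : E n ↦ (y - x) j := fun j ↦ by
    simp only [PiLp.sub_apply]
    fun_prop
  unfold stressField
  exact (h2.mul (h3 j)).sub (ContDiff.sum fun i _ ↦ (h1 i j).mul (h3 i))

/-- Derivatives falling on the tensor cancel by the conservation law. Those falling on $y-x$ leave
the trace $ne-\sum_jG_{jj}$, where $\sum_jG_{jj}=|d\phi|^2=2e+2V(\phi)$. -/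
theorem sum_fderiv_stressField {V : N → ℝ} (hV : ContMDiff (𝓡 m) 𝓘(ℝ, ℝ) ∞ V) {φ : E n → N}
    (hφ : IsHarmonicMapWithPotential (m := m) V φ) (x y : E n) :
    ∑ j, fderiv ℝ (stressField (m := m) V φ x j) y (stdVec j) =
      ((n : ℝ) - 2) * energyDensity (m := m) V φ y - 2 * V (φ y) := by
  have hG : ∀ i j, HasFDerivAt (pullbackMetric (m := m) φ i j)
      (fderiv ℝ (pullbackMetric (m := m) φ i j) y) y := fun i j ↦
    ((contDiff_pullbackMetric hφ.smooth i j).differentiable (by simp) y).hasFDerivAt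
  have hP : HasFDerivAt (fun y ↦ V (φ y)) (fderiv ℝ (fun y ↦ V (φ y)) y) y :=
    ((contDiff_potential_comp hV hφ.smooth).differentiable (by simp) y).hasFDerivAt
  have he : HasFDerivAt (energyDensity (m := m) V φ)
      ((1 / 2 : ℝ) • ∑ i, fderiv ℝ (pullbackMetric (m := m) φ i i) y -
        fderiv ℝ (fun y ↦ V (φ y)) y) y := by
    rw [energyDensity_eq]
    exact ((HasFDerivAt.fun_sum fun i _ ↦ hG i i).const_mul _).sub hP
  have hc : ∀ j, HasFDerivAt (fun y : E n ↦ (y - x) j) (EuclideanSpace.proj (𝕜 := ℝ) j) y :=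
    fun j ↦ (EuclideanSpace.proj (𝕜 := ℝ) j).hasFDerivAt.comp y ((hasFDerivAt_id y).sub_const x)
  have hstd : ∀ i j : Fin n, (stdVec j : E n) i = if i = j then 1 else 0 := fun i j ↦ by
    simp [stdVec]
  have key : ∀ j, fderiv ℝ (stressField (m := m) V φ x j) y (stdVec j) =
      energyDensity (m := m) V φ y - pullbackMetric (m := m) φ j j y +
        (y - x) j * (∑ i, fderiv ℝ (pullbackMetric (m := m) φ i j) y (stdVec i)) -
        ∑ i, (y - x) i * fderiv ℝ (pullbackMetric (m := m) φ j i) y (stdVec j) := fun j ↦ by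
    have h : HasFDerivAt (stressField (m := m) V φ x j) _ y :=
      (he.mul (hc j)).sub (HasFDerivAt.fun_sum (u := Finset.univ)
        fun (i : Fin n) _ ↦ (hG i j).mul (hc i))
    have hcomm : ∀ i, pullbackMetric (m := m) φ i j = pullbackMetric (m := m) φ j i := fun i ↦
      funext fun y ↦ pullbackMetric_comm φ i j y
    rw [h.fderiv, sum_fderiv_pullbackMetric hV hφ]
    simp [sum_apply, hstd, Finset.sum_add_distrib, hcomm]
    ring
  simp only [key, Finset.sum_add_distrib, Finset.sum_sub_distrib, Finset.mul_sum]
  -- Exchanging $i$ and $j$ identifies this sum with the divergence terms already present, and the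
  -- two cancel.
  rw [Finset.sum_comm (f := fun j i ↦ (y - x) i *
    fderiv ℝ (pullbackMetric (m := m) φ j i) y (stdVec j)), add_sub_cancel_right]
  simp only [Finset.sum_const, Finset.card_univ, Fintype.card_fin, nsmul_eq_mul]
  simp only [energyDensity_eq]
  ring

/-- The divergence theorem for `stressField`: on the sphere $|y-x|^2=r^2$, and
$\sum_{i,j}G_{ij}(y-x)_i(y-x)_j=r^2|\partial\phi/\partial r|^2$. -/
theorem sphereIntegral_radialDeriv {V : N → ℝ} (hV : ContMDiff (𝓡 m) 𝓘(ℝ, ℝ) ∞ V)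
    {φ : E n → N} (hφ : IsHarmonicMapWithPotential (m := m) V φ) (x : E n) {r : ℝ} (hr : 0 < r) :
    r ^ 2 * sphereIntegral (energyDensity (m := m) V φ) x r -
        r ^ 2 * sphereIntegral (fun y ↦ ‖radialDeriv (m := m) φ x y‖ ^ 2) x r =
      r * (((n : ℝ) - 2) * (∫ y in Metric.ball x r, energyDensity (m := m) V φ y) -
        2 * ∫ y in Metric.ball x r, V (φ y)) := by
  have hGc := fun i j ↦ (contDiff_pullbackMetric (m := m) hφ.smooth i j).continuous
  have hec := (contDiff_energyDensity hV hφ.smooth).continuous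
  have hVc := (contDiff_potential_comp hV hφ.smooth).continuous
  have h := sphereIntegral_radial_eq_integral_divergence
    (fun j ↦ (contDiff_stressField hV hφ.smooth x j).of_le (by simp)) x hr
  simp only [sum_fderiv_stressField hV hφ] at h
  rw [integral_sub ((integrableOn_ball hec x r).const_mul _)
    ((integrableOn_ball hVc x r).const_mul _), integral_const_mul, integral_const_mul] at h
  rw [← h, ← sphereIntegral_const_mul, ← sphereIntegral_const_mul]
  have e1 : sphereIntegral (fun y ↦ r ^ 2 * ‖radialDeriv (m := m) φ x y‖ ^ 2) x r =
      sphereIntegral (fun y ↦ ∑ i, ∑ j,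
        pullbackMetric (m := m) φ i j y * (y - x) i * (y - x) j) x r := by
    refine sphereIntegral_congr hr.le fun y hy ↦ ?_
    rw [norm_radialDeriv_sq, hy, mul_inv_cancel_left₀ (by positivity)]
  rw [e1, ← sphereIntegral_sub (by fun_prop) (by fun_prop)]
  refine sphereIntegral_congr hr.le fun y hy ↦ ?_
  have hsq : r ^ 2 = ∑ j, (y - x) j * (y - x) j := by
    rw [← hy, EuclideanSpace.real_norm_sq_eq]
    exact Finset.sum_congr rfl fun j _ ↦ sq _
  rw [hsq, Finset.sum_mul, Finset.sum_comm, ← Finset.sum_sub_distrib]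
  refine Finset.sum_congr rfl fun j _ ↦ ?_
  simp only [stressField, mul_sub, Finset.mul_sum]
  congr 1
  · ring
  · exact Finset.sum_congr rfl fun i _ ↦ by ring

end Monotonicity

end HarmonicPotential

end

theorem mainTheorem6 {n m : ℕ} {N : Type*} [TopologicalSpace N]
    [ChartedSpace (EuclideanSpace ℝ (Fin m)) N] [IsManifold (𝓡 m) ∞ N]
    [Bundle.RiemannianBundle (fun q : N ↦ TangentSpace (𝓡 m) q)]
    [IsContMDiffRiemannianBundle (𝓡 m) ∞ (EuclideanSpace ℝ (Fin m))
      (fun q : N ↦ TangentSpace (𝓡 m) q)]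
    (V : N → ℝ) (hV : ContMDiff (𝓡 m) 𝓘(ℝ, ℝ) ∞ V)
    (φ : EuclideanSpace ℝ (Fin n) → N)
    (hφ : HarmonicPotential.IsHarmonicMapWithPotential (m := m) V φ)
    (x : EuclideanSpace ℝ (Fin n)) (r : ℝ) (hr : 0 < r) :
    MeasureTheory.IntegrableOn (HarmonicPotential.energyDensity (m := m) V φ) (Metric.ball x r) ∧
    MeasureTheory.IntegrableOn (fun y ↦ V (φ y)) (Metric.ball x r) ∧
    MeasureTheory.Integrable (fun y ↦ ‖HarmonicPotential.radialDeriv (m := m) φ x y‖ ^ 2)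
      (HarmonicPotential.surfaceMeasure x r) ∧
    HasDerivAt
      (fun ρ : ℝ ↦ ρ ^ (2 - (n : ℤ)) *
        ∫ y in Metric.ball x ρ, HarmonicPotential.energyDensity (m := m) V φ y)
      (r ^ (2 - (n : ℤ)) *
          (∫ y, ‖HarmonicPotential.radialDeriv (m := m) φ x y‖ ^ 2
            ∂(HarmonicPotential.surfaceMeasure x r)) -
        2 * r ^ (1 - (n : ℤ)) * ∫ y in Metric.ball x r, V (φ y))
      r := by
  have hGc := fun i j ↦
    (HarmonicPotential.contDiff_pullbackMetric (m := m) hφ.smooth i j).continuous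
  have hec := (HarmonicPotential.contDiff_energyDensity hV hφ.smooth).continuous
  have hVc := (HarmonicPotential.contDiff_potential_comp hV hφ.smooth).continuous
  have hQ : Continuous fun y : EuclideanSpace ℝ (Fin n) ↦ ∑ i, ∑ j,
      HarmonicPotential.pullbackMetric (m := m) φ i j y * (y - x) i * (y - x) j := by fun_prop
  have hmeas : Measurable fun y ↦ ‖HarmonicPotential.radialDeriv (m := m) φ x y‖ ^ 2 := by
    simp only [HarmonicPotential.norm_radialDeriv_sq]
    exact Measurable.mul (by fun_prop) hQ.measurable
  refine ⟨HarmonicPotential.integrableOn_ball hec x r, HarmonicPotential.integrableOn_ball hVc x r,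
    HarmonicPotential.integrable_surfaceMeasure hmeas (hQ.const_mul (r ^ 2)⁻¹) x hr.le
      fun y hy ↦ by rw [HarmonicPotential.norm_radialDeriv_sq, hy], ?_⟩
  rw [HarmonicPotential.integral_surfaceMeasure hmeas x hr.le]
  have key := HarmonicPotential.sphereIntegral_radialDeriv hV hφ x hr
  refine ((hasDerivAt_zpow (2 - (n : ℤ)) r (Or.inl hr.ne')).mul
    (HarmonicPotential.hasDerivAt_integral_ball hec x hr)).congr_deriv ?_
  -- All powers are written as multiples of $r^{-n}$, so that the claim becomes $r^{-n}$ times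
  -- `key`.
  have h1 : r ^ (2 - (n : ℤ)) = r ^ 2 * r ^ (-(n : ℤ)) := by
    rw [sub_eq_add_neg, zpow_add₀ hr.ne']
    norm_cast
  have h2 : r ^ (1 - (n : ℤ)) = r * r ^ (-(n : ℤ)) := by
    rw [sub_eq_add_neg, zpow_add₀ hr.ne', zpow_one]
  have h3 : r ^ (2 - (n : ℤ) - 1) = r * r ^ (-(n : ℤ)) := by
    rw [← h2]
    congr 1
    ring
  rw [h1, h2, h3]
  push_cast
  linear_combination r ^ (-(n : ℤ)) * key
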